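/- For an integer $n\ge 2$, a Screaming Toes mapping on $n$ points is a map $f:[n]\to[n]$ with $f(i)\neq i$ for all $i$. The random Screaming Toes mapping has $f(1),\dots,f(n)$ independent with $\mathbb P(f(i)=j)=1/(n-1)$ for $j\in[n]\setminus\{i\}$. Points $i,j$ are in the same component of $f$ if some iterate of $i$ equals some iterate of $j$, and $\tilde C_j(n)$ is the number of components of size $j$. Let $\tilde m_i$ be the number of connected (one-component) Screaming Toes mappings on $i$ points, let $\mathrm{Po}(\mu)$ denote a Poisson variable with mean $\mu$, and put $$\tilde\lambda_j=\frac1j\,\mathbb P(\mathrm{Po}(j)<j-1),\qquad \tilde s_j=\mathbb P(\tilde C_j(j)=1)\quad(j\ge 2),\qquad n_{[m]}=n(n-1)\cdots(n-m+1),$$ and define $\tilde\lambda_1$ by the same formula. 1. For every $i\ge1$, $\tilde m_i=(i-1)!\,e^i\,\mathbb P(\mathrm{Po}(i)<i-1)$; equivalently $\tilde\lambda_i=\tilde m_i e^{-i}/i!$. Let $n\ge2$. With the convention $0^0=1$: 2. For every $x>0$ and all integers $a_2,\dots,a_n\ge0$, $$\mathbb P(\tilde C_j(n)=a_j,\ 2\le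 j\le n)=\mathbf 1\Big\{\sum_{j=2}^n ja_j=n\Big\}\,\frac{x^{-n}\,n!}{(n-1)^n}\prod_{j=2}^n\Big(\frac{\tilde m_jx^j}{j!}\Big)^{a_j}\frac1{a_j!}.$$ 3. If $\tilde Z_2,\dots,\tilde Z_n$ are independent Poisson variables with means $\tilde\lambda_2,\dots,\tilde\lambda_n$, then $\mathbb P(\sum_{j=2}^n j\tilde Z_j=n)>0$ and $(\tilde C_2(n),\dots,\tilde C_n(n))$ has the law of $(\tilde Z_2,\dots,\tilde Z_n)$ conditioned on $\sum_{j=2}^n j\tilde Z_j=n$. 4. $\tilde s_n=\dfrac{e^n\,n!}{(n-1)^n}\,\tilde\lambda_n$. 5. For all integers $b$ and $r_2,\dots,r_b\ge0$ with $m=\sum_{j=2}^b jr_j\le n$, $$\mathbb E\prod_{j=2}^b\tilde C_j(n)_{[r_j]}=\Big(\prod_{j=2}^b\tilde\lambda_j^{r_j}\Big)\,e^m\,n_{[m]}\,\frac{(n-m-1)^{n-m}}{(n-1)^n},$$ where $\tilde C_j(n)=0$ for $j>n$. 6. For $2\le j\le n$, $$\mathbb E\,\tilde C_j(n)=\tilde\lambda_j\,e^j\,n_{[j]}\,\frac{(n-j-1)^{n-j}}{(n-1)^n}=\tilde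 s_j\binom nj\Big(\frac{j-1}{n-1}\Big)^j\Big(1-\frac j{n-1}\Big)^{n-j}.$$ 7. For $i,j\ge2$ with $i\neq j$ and $i+j\le n$, $$\mathbb E\,\tilde C_i(n)\tilde C_j(n)=\tilde s_i\tilde s_j\,\frac{n!}{i!\,j!\,(n-i-j)!}\Big(\frac{i-1}{n-1}\Big)^i\Big(\frac{j-1}{n-1}\Big)^j\Big(1-\frac{i+j}{n-1}\Big)^{n-i-j},$$ and $\mathbb E\,\tilde C_i(n)\tilde C_j(n)=0$ if $i\ne j$ and $i+j>n$. For $i=j$ the same two statements hold with $\tilde C_i(n)\tilde C_j(n)$ replaced by $\tilde C_j(n)(\tilde C_j(n)-1)$. -/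

import Mathlib

open MeasureTheory ProbabilityTheory
open scoped NNReal

namespace ScreamingToes

noncomputable section

/-- Two points are in the same component of the mapping `f` if some iterate of the one equals
some iterate of the other. -/
def componentSetoid {α : Type*} (f : α → α) : Setoid α where
  r x y := ∃ a b : ℕ, f^[a] x = f^[b] y
  iseqv :=
    { refl := fun _ => ⟨0, 0, rfl⟩
      symm := fun ⟨a, b, h⟩ => ⟨b, a, h.symm⟩
      trans := by
        rintro x y z ⟨a, b, h⟩ ⟨c, d, k⟩
        refine ⟨c + a, b + d, ?_⟩
        rw [Function.iterate_add_apply, h, ← Function.iterate_add_apply, Nat.add_comm c b,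
          Function.iterate_add_apply, k, ← Function.iterate_add_apply] }

/-- The number of components of size `j` of the mapping `f`. -/
def componentCount {α : Type*} (f : α → α) (j : ℕ) : ℕ :=
  {s : Set α | s ∈ (componentSetoid f).classes ∧ s.ncard = j}.ncard

/-- The number of connected Screaming Toes mappings on `i` points: mappings without fixed points
in which any two points are in the same component. -/
def connectedCount (i : ℕ) : ℕ :=
  Nat.card {f : Fin i → Fin i //
    (∀ x, f x ≠ x) ∧ ∀ x y, componentSetoid f x y}

/-- The law of the random Screaming Toes mapping `f` on `n` points (`n ≥ 2`): the values `f i` are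
independent, and `f i` is uniformly distributed on the `n - 1` points other than `i`. -/
def toesLaw (n : ℕ) : Measure (Fin n → Fin n) :=
  Measure.pi fun i => uniformOn {j : Fin n | j ≠ i}

/-- `P(Po(i) < i - 1)`, where `Po(i)` is Poisson with mean `i`. -/
def poissonBelow (i : ℕ) : ℝ≥0 :=
  (poissonMeasure (i : ℝ≥0) {k : ℕ | (k : ℤ) < (i : ℤ) - 1}).toNNReal

/-- `P(Po(j) < j - 1) / j`. -/
def toesRate (j : ℕ) : ℝ≥0 := poissonBelow j / (j : ℝ≥0)

/-- The probability that the random Screaming Toes mapping on `n` points has a single component,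
that is, one component of size `n`. -/
def singleProb (n : ℕ) : ℝ := (toesLaw n).real {f | componentCount f n = 1}

end

end ScreamingToes

open ScreamingToes

/-! Everything is counting with one recursion, `sum_toesMaps_succ`. A mapping without fixed points
on `n + 1` points is determined by the `k` other points in the component of `0`, a connected mapping
on these `k + 1` points, and an arbitrary mapping without fixed points on the remaining `n - k`.
Hence the sum of any function `Φ` of the component counts over all mappings reduces to sums over
smaller point sets, with weight `n.choose k * connectedCount (k + 1)`.

Three choices of `Φ` suffice. With `Φ = 1` the recursion is triangular and determines
`connectedCount` from the totals `(n - 1) ^ n`; an Abel-type identity of Cauchy shows that partial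
exponential sums, which are Poisson probabilities, solve it (`connectedCount_succ`). With `Φ` the
indicator of prescribed counts, induction gives the product formula for the joint law. With `Φ` a
product of falling factorials, induction gives the factorial moments.

In the joint law a factor `x ^ j` for each component of size `j` multiplies to `x ^ n`, so `x` is
free. The choice `x = exp (-1)` turns the weights into `toesRate`, and the law becomes a multiple of
a product of Poisson weights on the event of total size `n`: this is the conditioning relation. The
formulas with `singleProb` follow from `singleProb j = connectedCount j / (j - 1) ^ j`. -/

namespace ScreamingToes

/-! ### Components under conjugation and disjoint sums. -/

section Components

variable {α β : Type*}

theorem componentSetoid_semiconj {φ : α → β} (hφ : Function.Injective φ) {f : α → α} {g : β → β}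
    (h : Function.Semiconj φ f g) (x y : α) :
    componentSetoid g (φ x) (φ y) ↔ componentSetoid f x y := by
  change (∃ a b : ℕ, g^[a] (φ x) = g^[b] (φ y)) ↔ ∃ a b : ℕ, f^[a] x = f^[b] y
  simp only [← (h.iterate_right _).eq, hφ.eq_iff]

theorem componentSetoid_apply_self (f : α → α) (x : α) : componentSetoid f (f x) x :=
  ⟨0, 1, rfl⟩

theorem classes_eq_range (r : Setoid α) : r.classes = Set.range fun y => {x | r x y} := by
  ext s
  simp only [Setoid.classes, Set.mem_ofPred_eq, Set.mem_range, eq_comm]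

theorem classes_conj (e : α ≃ β) (f : α → α) :
    (componentSetoid (e ∘ f ∘ e.symm)).classes = Set.image e '' (componentSetoid f).classes := by
  have h : Function.Semiconj e f (e ∘ f ∘ e.symm) := fun x => by simp
  rw [classes_eq_range, classes_eq_range, ← Set.range_comp, ← e.surjective.range_comp]
  congr 1
  funext y
  ext x
  obtain ⟨x, rfl⟩ := e.surjective x
  simp [componentSetoid_semiconj e.injective h]

theorem componentCount_conj (e : α ≃ β) (f : α → α) :
    componentCount (e ∘ f ∘ e.symm) = componentCount f := by
  funext j
  unfold componentCount
  rw [classes_conj, ← Set.ncard_image_of_injective {s | s ∈ (componentSetoid f).classes ∧ _}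
    (Set.image_injective.2 e.injective)]
  congr 1
  ext s
  simp only [Set.mem_ofPred_eq, Set.mem_image]
  constructor
  · rintro ⟨⟨t, ht, rfl⟩, hs⟩
    exact ⟨t, ⟨ht, by rwa [Set.ncard_image_of_injective _ e.injective] at hs⟩, rfl⟩
  · rintro ⟨t, ⟨ht, hs⟩, rfl⟩
    exact ⟨⟨t, ht, rfl⟩, by rwa [Set.ncard_image_of_injective _ e.injective]⟩

theorem conj_injective (e : α ≃ β) :
    Function.Injective fun f : α → α => (e ∘ f ∘ e.symm : β → β) := by
  intro f g h
  funext x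
  simpa using congrFun h (e x)

theorem iterate_sumMap_inl (g : α → α) (h : β → β) (n : ℕ) (x : α) :
    (Sum.map g h)^[n] (Sum.inl x) = Sum.inl (g^[n] x) :=
  (((show Function.Semiconj Sum.inl g (Sum.map g h) from fun _ => rfl).iterate_right n).eq x).symm

theorem iterate_sumMap_inr (g : α → α) (h : β → β) (n : ℕ) (x : β) :
    (Sum.map g h)^[n] (Sum.inr x) = Sum.inr (h^[n] x) :=
  (((show Function.Semiconj Sum.inr h (Sum.map g h) from fun _ => rfl).iterate_right n).eq x).symm

theorem setOf_componentSetoid_inl (g : α → α) (h : β → β) (y : α) :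
    {x | componentSetoid (Sum.map g h) x (Sum.inl y)} =
      Sum.inl '' {x | componentSetoid g x y} := by
  ext (x | x)
  · simpa using componentSetoid_semiconj Sum.inl_injective
      (show Function.Semiconj Sum.inl g (Sum.map g h) from fun _ => rfl) x y
  · simp only [Set.mem_ofPred_eq, Set.mem_image, reduceCtorEq, and_false, exists_false, iff_false]
    rintro ⟨a, b, hab⟩
    rw [iterate_sumMap_inl, iterate_sumMap_inr] at hab
    cases hab

theorem setOf_componentSetoid_inr (g : α → α) (h : β → β) (y : β) :
    {x | componentSetoid (Sum.map g h) x (Sum.inr y)} =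
      Sum.inr '' {x | componentSetoid h x y} := by
  ext (x | x)
  · simp only [Set.mem_ofPred_eq, Set.mem_image, reduceCtorEq, and_false, exists_false, iff_false]
    rintro ⟨a, b, hab⟩
    rw [iterate_sumMap_inl, iterate_sumMap_inr] at hab
    cases hab
  · simpa using componentSetoid_semiconj Sum.inr_injective
      (show Function.Semiconj Sum.inr h (Sum.map g h) from fun _ => rfl) x y

theorem classes_sumMap (g : α → α) (h : β → β) :
    (componentSetoid (Sum.map g h)).classes =
      Set.image Sum.inl '' (componentSetoid g).classes ∪
        Set.image Sum.inr '' (componentSetoid h).classes := by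
  rw [classes_eq_range, classes_eq_range, classes_eq_range, ← Set.range_comp, ← Set.range_comp]
  ext s
  simp only [Set.mem_range, Set.mem_union, Sum.exists, setOf_componentSetoid_inl,
    setOf_componentSetoid_inr, Function.comp]

theorem componentCount_sumMap [Finite α] [Finite β] (g : α → α) (h : β → β) :
    componentCount (Sum.map g h) = componentCount g + componentCount h := by
  funext j
  simp only [Pi.add_apply]
  unfold componentCount
  rw [classes_sumMap,
    ← Set.ncard_image_of_injective {s | s ∈ (componentSetoid g).classes ∧ _}
      (Set.image_injective.2 (Sum.inl_injective (α := α) (β := β))),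
    ← Set.ncard_image_of_injective {s | s ∈ (componentSetoid h).classes ∧ _}
      (Set.image_injective.2 (Sum.inr_injective (α := α) (β := β))),
    ← Set.ncard_union_eq]
  · congr 1
    ext s
    simp only [Set.mem_ofPred_eq, Set.mem_image, Set.mem_union]
    constructor
    · rintro ⟨⟨t, ht, rfl⟩ | ⟨t, ht, rfl⟩, hs⟩
      · exact .inl ⟨t, ⟨ht, by rwa [Set.ncard_image_of_injective _ Sum.inl_injective] at hs⟩, rfl⟩
      · exact .inr ⟨t, ⟨ht, by rwa [Set.ncard_image_of_injective _ Sum.inr_injective] at hs⟩, rfl⟩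
    · rintro (⟨t, ⟨ht, hs⟩, rfl⟩ | ⟨t, ⟨ht, hs⟩, rfl⟩)
      · exact ⟨.inl ⟨t, ht, rfl⟩, by rwa [Set.ncard_image_of_injective _ Sum.inl_injective]⟩
      · exact ⟨.inr ⟨t, ht, rfl⟩, by rwa [Set.ncard_image_of_injective _ Sum.inr_injective]⟩
  -- Classes are nonempty, so an image under `Sum.inl` is never an image under `Sum.inr`.
  · rw [Set.disjoint_left]
    rintro _ ⟨s, ⟨hs, -⟩, rfl⟩ ⟨t, -, hst⟩
    obtain ⟨x, hx⟩ : s.Nonempty := by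
      rw [Set.nonempty_iff_ne_empty]
      rintro rfl
      exact Setoid.empty_notMem_classes hs
    have : (Sum.inl x : α ⊕ β) ∈ Sum.inr '' t := hst ▸ Set.mem_image_of_mem _ hx
    simp at this

/-- Nonemptiness matters: the empty mapping satisfies `hf` vacuously but has no components. -/
theorem componentCount_of_connected [Finite α] [Nonempty α] {f : α → α}
    (hf : ∀ x y, componentSetoid f x y) : componentCount f = Pi.single (Nat.card α) 1 := by
  have hc : (componentSetoid f).classes = {Set.univ} := by
    rw [classes_eq_range]
    have : (fun y => {x | componentSetoid f x y}) = fun _ => Set.univ := by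
      funext y
      exact Set.eq_univ_of_forall fun x => hf x y
    rw [this, Set.range_const]
  funext j
  unfold componentCount
  rw [hc]
  by_cases hj : j = Nat.card α
  · subst hj
    have : {s : Set α | s ∈ ({Set.univ} : Set (Set α)) ∧ s.ncard = Nat.card α} = {Set.univ} := by
      ext s
      simp only [Set.mem_ofPred_eq, Set.mem_singleton_iff, and_iff_left_iff_imp]
      rintro rfl
      exact Set.ncard_univ α
    rw [this]
    simp
  · have : {s : Set α | s ∈ ({Set.univ} : Set (Set α)) ∧ s.ncard = j} = ∅ := by
      ext s
      simp only [Set.mem_ofPred_eq, Set.mem_singleton_iff, Set.mem_empty_iff_false, iff_false]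
      rintro ⟨rfl, h⟩
      rw [Set.ncard_univ] at h
      exact hj h.symm
    rw [this]
    simp [hj]

theorem componentCount_of_isEmpty [IsEmpty α] (f : α → α) : componentCount f = 0 := by
  funext j
  have : {s : Set α | s ∈ (componentSetoid f).classes ∧ s.ncard = j} = ∅ := by
    rw [classes_eq_range, Set.range_eq_empty]
    simp
  simp [componentCount, this]

end Components

/-! ### The recursion that splits off one component. -/

section Recursion

noncomputable section

/-- The mappings of `α` to itself without fixed points. -/
def toesMaps (α : Type*) [Finite α] : Finset (α → α) :=
  (Set.toFinite {f : α → α | ∀ x, f x ≠ x}).toFinset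

/-- The mappings of `α` to itself without fixed points that have a single component. -/
def connectedMaps (α : Type*) [Finite α] : Finset (α → α) :=
  (Set.toFinite {f : α → α | (∀ x, f x ≠ x) ∧ ∀ x y, componentSetoid f x y}).toFinset

end

variable {α β : Type*} [Finite α] [Finite β]

@[simp]
theorem mem_toesMaps {f : α → α} : f ∈ toesMaps α ↔ ∀ x, f x ≠ x := by
  simp [toesMaps]

@[simp]
theorem mem_connectedMaps {f : α → α} :
    f ∈ connectedMaps α ↔ (∀ x, f x ≠ x) ∧ ∀ x y, componentSetoid f x y := by
  simp [connectedMaps]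

theorem card_connectedMaps_fin (n : ℕ) : (connectedMaps (Fin n)).card = connectedCount n := by
  rw [connectedMaps, connectedCount, ← Set.ncard_eq_toFinset_card, Set.ncard_def,
    Set.encard, Nat.card]
  rfl

theorem conj_mem_toesMaps (e : α ≃ β) {f : α → α} :
    e ∘ f ∘ e.symm ∈ toesMaps β ↔ f ∈ toesMaps α := by
  simp only [mem_toesMaps]
  rw [← e.forall_congr_right]
  simp

theorem conj_mem_connectedMaps (e : α ≃ β) {f : α → α} :
    e ∘ f ∘ e.symm ∈ connectedMaps β ↔ f ∈ connectedMaps α := by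
  have h : Function.Semiconj e f (e ∘ f ∘ e.symm) := fun x => by simp
  rw [mem_connectedMaps, mem_connectedMaps, ← mem_toesMaps, conj_mem_toesMaps, ← mem_toesMaps,
    ← e.forall_congr_right]
  simp only [← e.forall_congr_right (q := fun y => componentSetoid _ _ y),
    componentSetoid_semiconj e.injective h]

theorem sum_filter_toesMaps_conj (e : α ≃ β) (p : (β → β) → Prop) [DecidablePred p]
    (Φ : (ℕ → ℕ) → ℝ) :
    ∑ f ∈ toesMaps β with p f, Φ (componentCount f) =
      ∑ f ∈ toesMaps α with p (e ∘ f ∘ e.symm), Φ (componentCount f) := by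
  symm
  refine Finset.sum_nbij (fun f => e ∘ f ∘ e.symm) ?_ (conj_injective e).injOn ?_ ?_
  · intro f hf
    simpa only [Finset.mem_filter, conj_mem_toesMaps] using hf
  · intro g hg
    have hg' : e ∘ (e.symm ∘ g ∘ e) ∘ e.symm = g := by
      funext x
      simp
    refine ⟨e.symm ∘ g ∘ e, ?_, hg'⟩
    simp only [Finset.coe_filter, Set.mem_ofPred_eq] at hg ⊢
    rwa [← conj_mem_toesMaps e, hg']
  · intro f _
    rw [componentCount_conj]

theorem sum_toesMaps_conj (e : α ≃ β) (Φ : (ℕ → ℕ) → ℝ) :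
    ∑ f ∈ toesMaps β, Φ (componentCount f) = ∑ f ∈ toesMaps α, Φ (componentCount f) := by
  simpa using sum_filter_toesMaps_conj e (fun _ => True) Φ

theorem card_connectedMaps (α : Type*) [Finite α] :
    (connectedMaps α).card = connectedCount (Nat.card α) := by
  rw [← card_connectedMaps_fin]
  have e := Finite.equivFin α
  refine Finset.card_nbij (fun f => e ∘ f ∘ e.symm) ?_ (conj_injective e).injOn ?_
  · intro f hf
    exact (conj_mem_connectedMaps e).2 hf
  · intro g hg
    have hg' : e ∘ (e.symm ∘ g ∘ e) ∘ e.symm = g := by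
      funext x
      simp
    refine ⟨e.symm ∘ g ∘ e, ?_, hg'⟩
    simp only [Finset.mem_coe] at hg ⊢
    rwa [← conj_mem_connectedMaps e, hg']

-- A mapping for which the component of `inl a` is all of the left summand is the same as a pair: a
-- connected mapping on the left and any fixed-point-free mapping on the right.
open Classical in
theorem sum_toesMaps_sum (a : α) (Φ : (ℕ → ℕ) → ℝ) :
    ∑ f ∈ toesMaps (α ⊕ β) with {x | componentSetoid f x (Sum.inl a)} = Set.range Sum.inl,
        Φ (componentCount f) =
      connectedCount (Nat.card α) *
        ∑ h ∈ toesMaps β, Φ (Pi.single (Nat.card α) 1 + componentCount h) := by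
  have : Nonempty α := ⟨a⟩
  rw [← card_connectedMaps, ← nsmul_eq_mul, ← Finset.sum_const, ← Finset.sum_product']
  symm
  refine Finset.sum_nbij (fun p => Sum.map p.1 p.2) ?_ ?_ ?_ ?_
  · rintro ⟨g, h⟩ hgh
    simp only [Finset.mem_product, mem_connectedMaps, mem_toesMaps] at hgh
    rw [Finset.mem_filter, mem_toesMaps, setOf_componentSetoid_inl]
    refine ⟨?_, ?_⟩
    · rintro (x | x)
      · simpa using hgh.1.1 x
      · simpa using hgh.2 x
    · rw [← Set.image_univ]
      congr 1
      exact Set.eq_univ_of_forall fun x => hgh.1.2 x a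
  · rintro ⟨g, h⟩ - ⟨g', h'⟩ - heq
    simp only at heq
    refine Prod.ext (funext fun x => ?_) (funext fun x => ?_)
    · simpa using congrFun heq (Sum.inl x)
    · simpa using congrFun heq (Sum.inr x)
  -- A point and its image share a component, so `f` preserves both the component of `inl a` and its
  -- complement, hence is a `Sum.map`.
  · intro f hf
    simp only [Finset.coe_filter, Set.mem_ofPred_eq, mem_toesMaps] at hf
    obtain ⟨hf, hS⟩ := hf
    have hmem : ∀ x, componentSetoid f x (Sum.inl a) ↔ x ∈ Set.range Sum.inl := fun x => by
      rw [← hS]; rfl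
    have hinl : ∀ x : α, ∃ y : α, Sum.inl y = f (Sum.inl x) := fun x =>
      (hmem _).1 ((componentSetoid f).trans' (componentSetoid_apply_self f _)
        ((hmem _).2 ⟨x, rfl⟩))
    have hinr : ∀ x : β, ∃ y : β, Sum.inr y = f (Sum.inr x) := fun x => by
      rcases hx : f (Sum.inr x) with y | y
      · have h1 := (hmem _).2 ⟨y, rfl⟩
        rw [← hx] at h1
        have h2 := (hmem _).1 ((componentSetoid f).trans'
          ((componentSetoid f).symm' (componentSetoid_apply_self f _)) h1)
        simp at h2
      · exact ⟨y, rfl⟩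
    choose g hg using hinl
    choose h hh using hinr
    have hfgh : Sum.map g h = f := by
      funext x
      rcases x with x | x
      · exact hg x
      · exact hh x
    subst hfgh
    refine ⟨(g, h), ?_, rfl⟩
    simp only [Finset.coe_product, Set.mem_prod, Finset.mem_coe, mem_connectedMaps, mem_toesMaps]
    refine ⟨⟨fun x hx => hf (Sum.inl x) (by simp [hx]), fun x y => ?_⟩,
      fun x hx => hf (Sum.inr x) (by simp [hx])⟩
    have hxy := (componentSetoid (Sum.map g h)).trans' ((hmem (Sum.inl x)).2 ⟨x, rfl⟩)
      ((componentSetoid _).symm' ((hmem (Sum.inl y)).2 ⟨y, rfl⟩))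
    exact (componentSetoid_semiconj Sum.inl_injective
      (show Function.Semiconj Sum.inl g (Sum.map g h) from fun _ => rfl) x y).1 hxy
  · rintro ⟨g, h⟩ hgh
    simp only [Finset.mem_product, mem_connectedMaps] at hgh
    rw [componentCount_sumMap, componentCount_of_connected hgh.1.2]

-- Conjugation by `Equiv.sumCompl` transports the case of a disjoint sum to an arbitrary component
-- `S`.
open Classical in
theorem sum_toesMaps_component (a : α) (S : Finset α) (ha : a ∈ S) (Φ : (ℕ → ℕ) → ℝ) :
    ∑ f ∈ toesMaps α with {x | componentSetoid f x a} = (S : Set α), Φ (componentCount f) =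
      connectedCount S.card *
        ∑ h ∈ toesMaps (Fin (Nat.card α - S.card)), Φ (Pi.single S.card 1 + componentCount h) := by
  have hS : Nat.card {x // x ∈ S} = S.card := by simp
  have hSc : Nat.card {x // x ∉ S} = Nat.card α - S.card := by
    have := Nat.card_congr (Equiv.sumCompl (· ∈ S))
    rw [Nat.card_sum] at this
    omega
  have e := Finite.equivFinOfCardEq hSc
  have he : ∑ h ∈ toesMaps (Fin (Nat.card α - S.card)),
      Φ (Pi.single S.card 1 + componentCount h) =
      ∑ h ∈ toesMaps {x // x ∉ S}, Φ (Pi.single S.card 1 + componentCount h) :=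
    sum_toesMaps_conj e fun c => Φ (Pi.single S.card 1 + c)
  rw [he, ← hS,
    ← sum_toesMaps_sum (⟨a, ha⟩ : {x // x ∈ S}), sum_filter_toesMaps_conj (Equiv.sumCompl (· ∈ S))]
  refine Finset.sum_congr (Finset.filter_congr fun f _ => ?_) fun _ _ => rfl
  have hsemi : Function.Semiconj (Equiv.sumCompl (· ∈ S)) f
      (Equiv.sumCompl (· ∈ S) ∘ f ∘ (Equiv.sumCompl (· ∈ S)).symm) := fun x => by simp
  rw [← (Equiv.sumCompl (· ∈ S)).injective.image_injective.eq_iff, ← Set.range_comp]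
  have h1 : Set.range ((Equiv.sumCompl (· ∈ S)) ∘ Sum.inl) = (S : Set α) := by
    ext x
    simp
  have h2 : (Equiv.sumCompl (· ∈ S)) '' {x | componentSetoid f x (Sum.inl ⟨a, ha⟩)} =
      {x | componentSetoid (Equiv.sumCompl (· ∈ S) ∘ f ∘ (Equiv.sumCompl (· ∈ S)).symm) x a} := by
    ext x
    obtain ⟨x, rfl⟩ := (Equiv.sumCompl (· ∈ S)).surjective x
    rw [(Equiv.sumCompl (· ∈ S)).injective.mem_set_image]
    exact (componentSetoid_semiconj (Equiv.injective _) hsemi x (Sum.inl ⟨a, ha⟩)).symm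
  rw [h1, h2]

/-- Splitting off the component of one point. -/
theorem sum_toesMaps_succ (n : ℕ) (Φ : (ℕ → ℕ) → ℝ) :
    ∑ f ∈ toesMaps (Fin (n + 1)), Φ (componentCount f) =
      ∑ k ∈ Finset.range (n + 1), (n.choose k : ℝ) * (connectedCount (k + 1) *
        ∑ h ∈ toesMaps (Fin (n - k)), Φ (Pi.single (k + 1) 1 + componentCount h)) := by
  classical
  -- The mappings are grouped by the component of `0` with `0` removed. The sum over a group depends
  -- only on the size of this set, which produces the binomial coefficients.
  have hmap : ∀ f ∈ toesMaps (Fin (n + 1)),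
      ({x | componentSetoid f x 0} : Finset (Fin (n + 1))).erase 0 ∈
        (Finset.univ.erase (0 : Fin (n + 1))).powerset := fun f _ =>
    Finset.mem_powerset.2 (Finset.erase_subset_erase _ (Finset.subset_univ _))
  rw [← Finset.sum_fiberwise_of_maps_to hmap]
  have hcard : (Finset.univ.erase (0 : Fin (n + 1))).card = n := by simp
  have key := Finset.sum_powerset_apply_card (x := Finset.univ.erase (0 : Fin (n + 1)))
    (fun k => (connectedCount (k + 1) : ℝ) *
    ∑ h ∈ toesMaps (Fin (n - k)), Φ (Pi.single (k + 1) 1 + componentCount h))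
  rw [hcard] at key
  simp only [nsmul_eq_mul] at key
  rw [← key]
  refine Finset.sum_congr rfl fun T hT => ?_
  have h0 : (0 : Fin (n + 1)) ∉ T := fun h => by
    simpa using Finset.mem_powerset.1 hT h
  have hc : (insert 0 T).card = T.card + 1 := Finset.card_insert_of_notMem h0
  have := sum_toesMaps_component (0 : Fin (n + 1)) (insert 0 T) (Finset.mem_insert_self _ _) Φ
  rw [hc, Nat.card_fin, Nat.add_sub_add_right] at this
  rw [← this]
  refine Finset.sum_congr (Finset.filter_congr fun f _ => ?_) fun _ _ => rfl
  have h00 : (0 : Fin (n + 1)) ∈ ({x | componentSetoid f x 0} : Finset (Fin (n + 1))) := by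
    simp
  rw [Finset.erase_eq_iff_eq_insert h00 h0, ← Finset.coe_inj]
  simp

theorem sum_toesMaps_zero (Φ : (ℕ → ℕ) → ℝ) :
    ∑ f ∈ toesMaps (Fin 0), Φ (componentCount f) = Φ 0 := by
  have : toesMaps (Fin 0) = Finset.univ := by
    ext f
    exact iff_of_true (mem_toesMaps.2 fun x => x.elim0) (Finset.mem_univ f)
  rw [this, Fintype.sum_unique, componentCount_of_isEmpty]

/-- The subtraction is real, so `n = 0` gives `(-1) ^ 0 = 1`, the empty mapping. -/
theorem card_toesMaps (n : ℕ) : ((toesMaps (Fin n)).card : ℝ) = ((n : ℝ) - 1) ^ n := by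
  classical
  have h : toesMaps (Fin n) = Fintype.piFinset fun i : Fin n => Finset.univ.erase i := by
    ext f
    simp
  rw [h, Fintype.card_piFinset]
  rcases n with _ | n
  · simp
  · simp

theorem connectedCount_one : connectedCount 1 = 0 := by
  rw [← card_connectedMaps_fin, Finset.card_eq_zero, Finset.eq_empty_iff_forall_notMem]
  intro f hf
  exact (mem_connectedMaps.1 hf).1 0 (Subsingleton.elim _ _)

end Recursion

/-! ### Abel-type identities. -/

section AbelIdentity

/-- The `n`-th difference of the `n`-th power. -/
theorem sum_choose_mul_pow_mul_neg_pow (n : ℕ) (x : ℝ) :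
    ∑ i ∈ Finset.range (n + 1), (n.choose i : ℝ) * (x + i) ^ i * (-(x + i)) ^ (n - i) =
      n.factorial := by
  have h := congrFun (fwdDiff_iter_eq_factorial (R := ℝ) (n := n)) x
  rw [fwdDiff_iter_eq_sum_shift] at h
  simp only [Pi.natCast_apply] at h
  rw [← h]
  refine Finset.sum_congr rfl fun i hi => ?_
  have hi' : i ≤ n := Nat.lt_succ_iff.1 (Finset.mem_range.1 hi)
  rw [neg_pow, zsmul_eq_mul, nsmul_eq_mul]
  push_cast
  rw [mul_one, show (x + i) ^ n = (x + i) ^ i * (x + i) ^ (n - i) by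
    rw [← pow_add, Nat.add_sub_cancel' hi']]
  ring

/-- Cauchy's identity of Abel type. -/
theorem sum_choose_mul_add_pow_mul_add_pow (n : ℕ) (x y : ℝ) :
    ∑ i ∈ Finset.range (n + 1), (n.choose i : ℝ) * (x + i) ^ i * (y + n - i) ^ (n - i) =
      ∑ l ∈ Finset.range (n + 1), (n.descFactorial l : ℝ) * (x + y + n) ^ (n - l) := by
  induction n generalizing y with
  | zero => simp
  | succ n ih =>
    set F : ℝ → ℝ := fun y =>
      ∑ i ∈ Finset.range (n + 1 + 1),
          ((n + 1).choose i : ℝ) * (x + i) ^ i * (y + (n + 1 : ℕ) - i) ^ (n + 1 - i) -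
        ∑ l ∈ Finset.range (n + 1 + 1),
          ((n + 1).descFactorial l : ℝ) * (x + y + (n + 1 : ℕ)) ^ (n + 1 - l) with hF
    -- Differentiating in `y` turns each side into `n + 1` times the side for `n` at `y + 1`, so the
    -- difference `F` is constant by induction.
    have hder : ∀ y, HasDerivAt F 0 y := by
      intro y
      have h1 := HasDerivAt.fun_sum (u := Finset.range (n + 1 + 1)) (x := y)
        (A := fun i y => ((n + 1).choose i : ℝ) * (x + i) ^ i * (y + (n + 1 : ℕ) - i) ^ (n + 1 - i))
        fun i _ => ((((hasDerivAt_id y).add_const ((n + 1 : ℕ) : ℝ)).sub_const (i : ℝ)).pow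
          (n + 1 - i)).const_mul (((n + 1).choose i : ℝ) * (x + i) ^ i)
      have h2 := HasDerivAt.fun_sum (u := Finset.range (n + 1 + 1)) (x := y)
        (A := fun l y => ((n + 1).descFactorial l : ℝ) * (x + y + (n + 1 : ℕ)) ^ (n + 1 - l))
        fun l _ => ((((hasDerivAt_id y).const_add x).add_const ((n + 1 : ℕ) : ℝ)).pow
          (n + 1 - l)).const_mul ((n + 1).descFactorial l : ℝ)
      refine (h1.sub h2).congr_deriv ?_
      rw [Finset.sum_range_succ, Finset.sum_range_succ _ (n + 1)]
      simp only [Nat.sub_self, Nat.cast_zero, zero_mul, mul_zero, add_zero, id_eq, mul_one]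
      rw [sub_eq_zero]
      have hy := congrArg (fun z => ((n : ℝ) + 1) * z) (ih (y + 1))
      simp only [Finset.mul_sum] at hy
      convert hy using 1
      · refine Finset.sum_congr rfl fun i hi => ?_
        have hi' : i ≤ n := Nat.lt_succ_iff.1 (Finset.mem_range.1 hi)
        have hc : ((n.choose i : ℕ) : ℝ) * (n + 1) = (n + 1).choose i * ((n + 1 - i : ℕ) : ℝ) := by
          exact_mod_cast Nat.choose_mul_succ_eq n i
        rw [show n + 1 - i - 1 = n - i by omega]
        push_cast
        linear_combination (-(x + i) ^ i * (y + (n + 1) - i) ^ (n - i)) * hc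
      · refine Finset.sum_congr rfl fun l hl => ?_
        have hd : ((n + 1 - l : ℕ) : ℝ) * (n + 1).descFactorial l =
            (n + 1) * n.descFactorial l := by
          rw [← Nat.cast_mul, ← Nat.descFactorial_succ, Nat.succ_descFactorial_succ]
          push_cast
          rfl
        rw [show n + 1 - l - 1 = n - l by omega]
        push_cast
        linear_combination ((x + y + (n + 1)) ^ (n - l)) * hd
    have hconst := is_const_of_deriv_eq_zero (fun y => (hder y).differentiableAt)
      (fun y => (hder y).deriv) y (-x - (n + 1 : ℕ))
    -- At this `y` the base on the right vanishes, leaving only `(n + 1)!`, while the left side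
    -- becomes an iterated difference of a power.
    have hzero : F (-x - (n + 1 : ℕ)) = 0 := by
      rw [hF]
      simp only
      rw [sub_eq_zero, Finset.sum_range_succ (fun l => ((n + 1).descFactorial l : ℝ) * _),
        Finset.sum_eq_zero (s := Finset.range (n + 1)), Nat.descFactorial_self]
      · simp only [Nat.sub_self, pow_zero, mul_one, zero_add]
        rw [← sum_choose_mul_pow_mul_neg_pow (n + 1) x]
        refine Finset.sum_congr rfl fun i _ => ?_
        congr 2
        ring
      · intro l hl
        have := Finset.mem_range.1 hl
        rw [show x + (-x - ((n + 1 : ℕ) : ℝ)) + ((n + 1 : ℕ) : ℝ) = 0 by ring, zero_pow (by omega),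
          mul_zero]
    rw [hzero] at hconst
    exact sub_eq_zero.1 hconst

theorem sum_range_sum_range_pow_div_factorial (n : ℕ) (x : ℝ) :
    ∑ m ∈ Finset.range n, ∑ p ∈ Finset.range (m + 1), x ^ p / (p.factorial : ℝ) =
      (n - x) * ∑ p ∈ Finset.range n, x ^ p / (p.factorial : ℝ) +
        n * (x ^ n / (n.factorial : ℝ)) := by
  induction n with
  | zero => simp
  | succ n ih =>
    rw [Finset.sum_range_succ, ih, Finset.sum_range_succ, Nat.factorial_succ, pow_succ]
    have : (n.factorial : ℝ) ≠ 0 := by positivity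
    have : (n : ℝ) + 1 ≠ 0 := by positivity
    push_cast
    field_simp
    ring

/-- This is the recursion of `sum_choose_mul_connectedCount` with the proposed closed form in place
of the count. -/
theorem sum_choose_mul_partialExp (n : ℕ) :
    ∑ k ∈ Finset.range (n + 1), (n.choose k : ℝ) *
        ((k.factorial : ℝ) * ∑ l ∈ Finset.range k, ((k : ℝ) + 1) ^ l / (l.factorial : ℝ)) *
        (((n - k : ℕ) : ℝ) - 1) ^ (n - k) =
      (n : ℝ) ^ (n + 1) := by
  have hswap : ∑ k ∈ Finset.range (n + 1), (n.choose k : ℝ) *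
        ((k.factorial : ℝ) * ∑ l ∈ Finset.range k, ((k : ℝ) + 1) ^ l / (l.factorial : ℝ)) *
        (((n - k : ℕ) : ℝ) - 1) ^ (n - k) =
      ∑ m ∈ Finset.range n, ∑ i ∈ Finset.range (m + 1), (n.factorial : ℝ) / m.factorial *
        ((m.choose i : ℝ) * (((n - m : ℕ) : ℝ) + 1 + i) ^ i * (-1 + m - i) ^ (m - i)) := by
    simp only [Finset.mul_sum, Finset.sum_mul]
    rw [Finset.sum_sigma', Finset.sum_sigma']
    -- Grouping by `m = n - (k - l)`, with `i = l`, makes each inner sum a Cauchy sum of order `m`.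
    refine Finset.sum_nbij' (fun p => ⟨n - (p.1 - p.2), p.2⟩) (fun p => ⟨n - p.1 + p.2, p.2⟩)
      ?_ ?_ ?_ ?_ ?_
    · rintro ⟨k, l⟩ h
      simp only [Finset.mem_sigma, Finset.mem_range] at h ⊢
      omega
    · rintro ⟨m, i⟩ h
      simp only [Finset.mem_sigma, Finset.mem_range] at h ⊢
      omega
    · rintro ⟨k, l⟩ h
      simp only [Finset.mem_sigma, Finset.mem_range] at h ⊢
      rw [show n - (n - (k - l)) + l = k by omega]
    · rintro ⟨m, i⟩ h
      simp only [Finset.mem_sigma, Finset.mem_range] at h ⊢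
      rw [show n - (n - m + i - i) = m by omega]
    · rintro ⟨k, l⟩ h
      simp only [Finset.mem_sigma, Finset.mem_range] at h ⊢
      obtain ⟨d, rfl⟩ : ∃ d, k = l + d := ⟨k - l, by omega⟩
      obtain ⟨e, rfl⟩ : ∃ e, n = l + d + e := ⟨n - (l + d), by omega⟩
      rw [show l + d + e - (l + d - l) = l + e by omega, show l + d + e - (l + d) = e by omega,
        show l + d + e - (l + e) = d by omega, show l + e - l = e by omega,
        Nat.cast_add_choose, Nat.cast_add_choose]
      have h1 : ((l + d).factorial : ℝ) ≠ 0 := by positivity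
      have h2 : ((l + e).factorial : ℝ) ≠ 0 := by positivity
      have h3 : (l.factorial : ℝ) ≠ 0 := by positivity
      have h4 : (e.factorial : ℝ) ≠ 0 := by positivity
      push_cast
      rw [show (-1 : ℝ) + (l + e) - l = e - 1 by ring, show (d : ℝ) + 1 + l = l + d + 1 by ring]
      field_simp
  rw [hswap]
  have hin : ∀ m ∈ Finset.range n, ∑ i ∈ Finset.range (m + 1), (n.factorial : ℝ) / m.factorial *
        ((m.choose i : ℝ) * (((n - m : ℕ) : ℝ) + 1 + i) ^ i * (-1 + m - i) ^ (m - i)) =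
      (n.factorial : ℝ) * ∑ p ∈ Finset.range (m + 1), (n : ℝ) ^ p / p.factorial := by
    intro m hm
    have hm' := (Finset.mem_range.1 hm).le
    -- Cauchy's identity is used at `x = n - m + 1`, `y = -1`, so that `x + y + m = n` for every
    -- `m`.
    rw [← Finset.mul_sum, sum_choose_mul_add_pow_mul_add_pow, ← Finset.sum_range_reflect,
      Finset.mul_sum, Finset.mul_sum]
    refine Finset.sum_congr rfl fun p hp => ?_
    have hp' : p ≤ m := Nat.lt_succ_iff.1 (Finset.mem_range.1 hp)
    have hd := Nat.factorial_mul_descFactorial (show m - p ≤ m by omega)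
    rw [show m - (m - p) = p by omega] at hd
    have hd' : (p.factorial : ℝ) * m.descFactorial (m - p) = m.factorial := by exact_mod_cast hd
    rw [show m + 1 - 1 - p = m - p by omega, show m - (m - p) = p by omega, ← hd',
      Nat.cast_sub hm', show (n : ℝ) - m + 1 + -1 + m = n by ring]
    have h1 : (p.factorial : ℝ) ≠ 0 := by positivity
    have h2 : (m.descFactorial (m - p) : ℝ) ≠ 0 := by
      rw [Nat.cast_ne_zero, Ne, Nat.descFactorial_eq_zero_iff_lt]
      omega
    field_simp
  -- The double sum is evaluated at `x = n`, where the term with factor `n - x` disappears.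
  rw [Finset.sum_congr rfl hin, ← Finset.mul_sum, sum_range_sum_range_pow_div_factorial]
  have : (n.factorial : ℝ) ≠ 0 := by positivity
  field_simp
  ring

end AbelIdentity

/-! ### Connected mappings, the joint law and factorial moments as counts. -/

section Counting

theorem sum_choose_mul_connectedCount (n : ℕ) :
    ∑ k ∈ Finset.range (n + 1), (n.choose k : ℝ) * connectedCount (k + 1) *
        (((n - k : ℕ) : ℝ) - 1) ^ (n - k) =
      (n : ℝ) ^ (n + 1) := by
  have h := sum_toesMaps_succ n fun _ => 1
  simp only [Finset.sum_const, nsmul_eq_mul, mul_one, card_toesMaps] at h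
  push_cast at h
  rw [add_sub_cancel_right] at h
  rw [h]
  simp only [mul_assoc]

/-- Both sides solve the same recursion, in which the term `k = n` has coefficient `1` and so is
determined by the earlier ones. -/
theorem connectedCount_succ (n : ℕ) :
    (connectedCount (n + 1) : ℝ) =
      (n.factorial : ℝ) * ∑ l ∈ Finset.range n, ((n : ℝ) + 1) ^ l / (l.factorial : ℝ) := by
  induction n using Nat.strong_induction_on with
  | _ n ih =>
    have h := (sum_choose_mul_connectedCount n).trans (sum_choose_mul_partialExp n).symm
    rw [Finset.sum_range_succ, Finset.sum_range_succ _ n,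
      Finset.sum_congr rfl fun k hk => by rw [ih k (Finset.mem_range.1 hk)]] at h
    simpa using h

theorem sum_range_ite_mem_Icc (b n : ℕ) (a : ℕ → ℕ)
    (h : ∑ j ∈ Finset.Icc 2 b, j * a j ≤ n + 1) :
    ∑ k ∈ Finset.range (n + 1), (if k + 1 ∈ Finset.Icc 2 b then (k + 1) * a (k + 1) else 0) =
      ∑ j ∈ Finset.Icc 2 b, j * a j := by
  have h0 := Finset.sum_range_succ' (fun j => if j ∈ Finset.Icc 2 b then j * a j else 0) (n + 1)
  simp only [zero_mul, ite_self, add_zero] at h0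
  rw [← h0, ← Finset.sum_filter]
  refine Finset.sum_subset (fun j hj => (Finset.mem_filter.1 hj).2) fun j hj hj' => ?_
  rcases Nat.eq_zero_or_pos (a j) with h1 | h1
  · simp [h1]
  · exfalso
    refine hj' (Finset.mem_filter.2 ⟨Finset.mem_range.2 ?_, hj⟩)
    have h2 := Finset.single_le_sum (f := fun j => j * a j) (fun _ _ => Nat.zero_le _) hj
    have h3 := Nat.le_mul_of_pos_right j h1
    omega

open Classical in
/-- The number of mappings with given component counts. -/
theorem sum_toesMaps_ite_componentCount (N : ℕ) (n : ℕ) (hn : n ≤ N) (a : ℕ → ℕ) :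
    ∑ f ∈ toesMaps (Fin n), (if ∀ j ∈ Finset.Icc 2 N, componentCount f j = a j then (1 : ℝ) else 0) =
      if ∑ j ∈ Finset.Icc 2 N, j * a j = n then
        (n.factorial : ℝ) * ∏ j ∈ Finset.Icc 2 N,
          (((connectedCount j : ℝ) / (j.factorial : ℝ)) ^ a j * (1 / ((a j).factorial : ℝ)))
      else 0 := by
  induction n using Nat.strong_induction_on generalizing a with
  | _ n ih =>
    rcases n with _ | n
    · rw [sum_toesMaps_zero fun c => if ∀ j ∈ Finset.Icc 2 N, c j = a j then (1 : ℝ) else 0]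
      have hiff : (∀ j ∈ Finset.Icc 2 N, (0 : ℕ → ℕ) j = a j) ↔
          ∑ j ∈ Finset.Icc 2 N, j * a j = 0 := by
        rw [Finset.sum_eq_zero_iff]
        refine forall₂_congr fun j hj => ?_
        have := (Finset.mem_Icc.1 hj).1
        rw [mul_eq_zero, Pi.zero_apply, eq_comm, or_iff_right (by omega)]
      by_cases h : ∀ j ∈ Finset.Icc 2 N, (0 : ℕ → ℕ) j = a j
      · rw [if_pos h, if_pos (hiff.1 h), Finset.prod_eq_one]
        · simp
        · intro j hj
          simp [← h j hj]
      · rw [if_neg h, if_neg (mt hiff.2 h)]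
    · rw [sum_toesMaps_succ n fun c => if ∀ j ∈ Finset.Icc 2 N, c j = a j then (1 : ℝ) else 0]
      set G : ℝ := if ∑ j ∈ Finset.Icc 2 N, j * a j = n + 1 then
        ((n + 1).factorial : ℝ) * ∏ j ∈ Finset.Icc 2 N,
          (((connectedCount j : ℝ) / (j.factorial : ℝ)) ^ a j * (1 / ((a j).factorial : ℝ)))
        else 0 with hG
      -- Size biasing: a share `(k + 1) * a (k + 1) / (n + 1)` of the mappings with counts `a` has
      -- the distinguished point in a component of size `k + 1`. These shares add to `1`.
      have hterm : ∀ k ∈ Finset.range (n + 1), (n.choose k : ℝ) * (connectedCount (k + 1) *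
          ∑ h ∈ toesMaps (Fin (n - k)), if ∀ j ∈ Finset.Icc 2 N,
            (Pi.single (k + 1) 1 + componentCount h : ℕ → ℕ) j = a j then (1 : ℝ) else 0) =
          ((if k + 1 ∈ Finset.Icc 2 N then (k + 1) * a (k + 1) else 0 : ℕ) : ℝ) *
            (G / (n + 1)) := by
        intro k hk
        have hk' : k ≤ n := Nat.lt_succ_iff.1 (Finset.mem_range.1 hk)
        by_cases hs : k + 1 ∈ Finset.Icc 2 N
        swap
        -- As `n + 1 ≤ N`, only size `1` is outside the range, and no connected mapping has one
        -- point.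
        · have : k = 0 := by
            rw [Finset.mem_Icc] at hs
            omega
          subst this
          rw [if_neg hs, zero_add, connectedCount_one]
          simp
        rw [if_pos hs]
        rcases hak : a (k + 1) with _ | t
        · rw [mul_zero, Nat.cast_zero, zero_mul, Finset.sum_eq_zero, mul_zero, mul_zero]
          intro f _
          rw [if_neg]
          intro h
          have := h _ hs
          simp [hak] at this
        · set a' := Function.update a (k + 1) t with ha'
          have hcond : ∀ c : ℕ → ℕ, (∀ j ∈ Finset.Icc 2 N,
              (Pi.single (k + 1) 1 + c : ℕ → ℕ) j = a j) ↔ ∀ j ∈ Finset.Icc 2 N, c j = a' j := by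
            intro c
            refine forall₂_congr fun j _ => ?_
            by_cases hj : j = k + 1
            · subst hj
              simp [ha', hak]
              omega
            · simp [ha', hj]
          have hcongr : (∑ h ∈ toesMaps (Fin (n - k)), if ∀ j ∈ Finset.Icc 2 N,
              (Pi.single (k + 1) 1 + componentCount h : ℕ → ℕ) j = a j then (1 : ℝ) else 0) =
              ∑ h ∈ toesMaps (Fin (n - k)), if ∀ j ∈ Finset.Icc 2 N,
                componentCount h j = a' j then (1 : ℝ) else 0 :=
            Finset.sum_congr rfl fun f _ => by
              by_cases h : ∀ j ∈ Finset.Icc 2 N, componentCount f j = a' j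
              · rw [if_pos h, if_pos ((hcond _).2 h)]
              · rw [if_neg h, if_neg (mt (hcond _).1 h)]
          rw [hcongr, ih (n - k) (by omega) (by omega) a']
          have hsum : ∑ j ∈ Finset.Icc 2 N, j * a j =
              (k + 1) + ∑ j ∈ Finset.Icc 2 N, j * a' j := by
            rw [← Finset.add_sum_erase _ _ hs, ← Finset.add_sum_erase _ _ hs, hak, ha',
              Function.update_self, Finset.sum_congr rfl fun j hj => by
                rw [← Function.update_of_ne (Finset.ne_of_mem_erase hj) t a]]
            ring
          by_cases hn1 : ∑ j ∈ Finset.Icc 2 N, j * a j = n + 1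
          · rw [hG, if_pos hn1, if_pos (by omega), ← Finset.mul_prod_erase _ _ hs,
              ← Finset.mul_prod_erase _ _ hs, hak, ha', Function.update_self,
              Finset.prod_congr rfl fun j hj => by
                rw [Function.update_of_ne (Finset.ne_of_mem_erase hj) t a],
              Nat.cast_choose ℝ hk', Nat.factorial_succ n, Nat.factorial_succ t,
              Nat.factorial_succ k, pow_succ]
            have h1 : (k.factorial : ℝ) ≠ 0 := by positivity
            have h2 : ((n - k).factorial : ℝ) ≠ 0 := by positivity
            have h3 : (t.factorial : ℝ) ≠ 0 := by positivity
            have h4 : (n : ℝ) + 1 ≠ 0 := by positivity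
            have h5 : (k : ℝ) + 1 ≠ 0 := by positivity
            have h6 : (t : ℝ) + 1 ≠ 0 := by positivity
            push_cast
            field_simp
          · rw [hG, if_neg hn1, if_neg (by omega)]
            simp
      rw [Finset.sum_congr rfl hterm, ← Finset.sum_mul, ← Nat.cast_sum]
      by_cases hn1 : ∑ j ∈ Finset.Icc 2 N, j * a j = n + 1
      · rw [sum_range_ite_mem_Icc N n a hn1.le, hn1]
        have h4 : (n : ℝ) + 1 ≠ 0 := by positivity
        push_cast
        field_simp
      · have : G = 0 := if_neg hn1
        simp [this]

/-- Were the total not `n`, the counting formula would say that no mapping has the counts of `f`,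
but `f` has them. -/
theorem sum_mul_componentCount {n N : ℕ} (hn : n ≤ N) {f : Fin n → Fin n}
    (hf : f ∈ toesMaps (Fin n)) :
    ∑ j ∈ Finset.Icc 2 N, j * componentCount f j = n := by
  classical
  by_contra h
  have h0 := sum_toesMaps_ite_componentCount N n hn (componentCount f)
  rw [if_neg h, Finset.sum_eq_zero_iff_of_nonneg fun _ _ => by positivity] at h0
  simpa using h0 f hf

theorem descFactorial_succ_left (c t : ℕ) :
    (c + 1).descFactorial (t + 1) = c.descFactorial (t + 1) + (t + 1) * c.descFactorial t := by
  rw [Nat.succ_descFactorial_succ, Nat.descFactorial_succ, ← add_mul]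
  rcases le_or_gt t c with h | h
  · rw [show c - t + (t + 1) = c + 1 by omega]
  · rw [Nat.descFactorial_eq_zero_iff_lt.2 h, mul_zero, mul_zero]

theorem choose_mul_descFactorial_sub (n k m : ℕ) :
    n.choose k * (n - k).descFactorial m = n.descFactorial m * (n - m).choose k := by
  have h1 := Nat.descFactorial_eq_factorial_mul_choose n k
  have h2 := Nat.descFactorial_eq_factorial_mul_choose (n - m) k
  have h3 := Nat.descFactorial_mul_descFactorial (n := n) (Nat.le_add_right k m)
  have h4 := Nat.descFactorial_mul_descFactorial (n := n) (Nat.le_add_left m k)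
  rw [Nat.add_sub_cancel_left] at h3
  rw [Nat.add_sub_cancel] at h4
  refine Nat.eq_of_mul_eq_mul_left (Nat.factorial_pos k) ?_
  rw [← mul_assoc, ← h1, mul_left_comm, ← h2, mul_comm, h3, mul_comm, h4]

/-- The sums that give the joint factorial moments. -/
theorem sum_toesMaps_prod_descFactorial (b n : ℕ) (r : ℕ → ℕ) (m : ℕ)
    (hm : m = ∑ j ∈ Finset.Icc 2 b, j * r j) :
    ∑ f ∈ toesMaps (Fin n), ∏ j ∈ Finset.Icc 2 b, ((componentCount f j).descFactorial (r j) : ℝ) =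
      (∏ j ∈ Finset.Icc 2 b, ((connectedCount j : ℝ) / (j.factorial : ℝ)) ^ r j) *
        ((n.descFactorial m : ℝ) * ((n : ℝ) - m - 1) ^ (n - m)) := by
  induction n using Nat.strong_induction_on generalizing r m with
  | _ n ih =>
    rcases n with _ | n
    · rw [sum_toesMaps_zero fun c => ∏ j ∈ Finset.Icc 2 b, ((c j).descFactorial (r j) : ℝ)]
      by_cases h : ∀ j ∈ Finset.Icc 2 b, r j = 0
      · have : m = 0 := by
          rw [hm]
          exact Finset.sum_eq_zero fun j hj => by rw [h j hj, mul_zero]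
        rw [Finset.prod_eq_one fun j hj => by rw [h j hj]; simp,
          Finset.prod_eq_one fun j hj => by rw [h j hj]; simp, this]
        simp
      · push Not at h
        obtain ⟨j, hj, hj0⟩ := h
        have hj2 := (Finset.mem_Icc.1 hj).1
        have hm0 : 0 < m := by
          rw [hm]
          exact Finset.sum_pos' (fun _ _ => Nat.zero_le _)
            ⟨j, hj, Nat.mul_pos (by omega) (Nat.pos_of_ne_zero hj0)⟩
        rw [Finset.prod_eq_zero hj, Nat.descFactorial_eq_zero_iff_lt.2 hm0]
        · simp
        · rw [Pi.zero_apply, Nat.descFactorial_eq_zero_iff_lt.2 (Nat.pos_of_ne_zero hj0)]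
          simp
    · rw [sum_toesMaps_succ n fun c => ∏ j ∈ Finset.Icc 2 b, ((c j).descFactorial (r j) : ℝ)]
      set P : ℝ := ∏ j ∈ Finset.Icc 2 b, ((connectedCount j : ℝ) / (j.factorial : ℝ)) ^ r j with hP
      -- Adding one component of size `k + 1` changes a falling factorial by the Pascal rule
      -- `descFactorial_succ_left`: one part keeps `r`, the other lowers `r (k + 1)` by one.
      have hterm : ∀ k ∈ Finset.range (n + 1), (n.choose k : ℝ) * (connectedCount (k + 1) *
          ∑ h ∈ toesMaps (Fin (n - k)), ∏ j ∈ Finset.Icc 2 b,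
            (((Pi.single (k + 1) 1 + componentCount h : ℕ → ℕ) j).descFactorial (r j) : ℝ)) =
          (n.choose k : ℝ) * connectedCount (k + 1) *
            (P * (((n - k).descFactorial m : ℝ) * (((n - k : ℕ) : ℝ) - m - 1) ^ (n - k - m))) +
          ((if k + 1 ∈ Finset.Icc 2 b then (k + 1) * r (k + 1) else 0 : ℕ) : ℝ) *
            (P * ((n.descFactorial (m - 1) : ℝ) * ((n : ℝ) - m) ^ (n + 1 - m))) := by
        intro k hk
        have hk' : k ≤ n := Nat.lt_succ_iff.1 (Finset.mem_range.1 hk)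
        rw [← ih (n - k) (by omega) r m hm]
        by_cases hs : k + 1 ∈ Finset.Icc 2 b ∧ r (k + 1) ≠ 0
        swap
        · have h0 : (if k + 1 ∈ Finset.Icc 2 b then (k + 1) * r (k + 1) else 0) = 0 := by
            rw [not_and_not_right] at hs
            split_ifs with h
            · rw [hs h, mul_zero]
            · rfl
          rw [h0, Nat.cast_zero, zero_mul, add_zero, mul_assoc]
          congr 2
          refine Finset.sum_congr rfl fun f _ => Finset.prod_congr rfl fun j hj => ?_
          by_cases hjk : j = k + 1
          · subst hjk
            have : r (k + 1) = 0 := by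
              by_contra h
              exact hs ⟨hj, h⟩
            simp [this]
          · simp [hjk]
        obtain ⟨hs, hr⟩ := hs
        obtain ⟨t, ht⟩ := Nat.exists_eq_succ_of_ne_zero hr
        rw [Nat.succ_eq_add_one] at ht
        set r' := Function.update r (k + 1) t with hr'
        have hsum : m = (k + 1) + ∑ j ∈ Finset.Icc 2 b, j * r' j := by
          rw [hm, ← Finset.add_sum_erase _ _ hs, ← Finset.add_sum_erase _ _ hs, ht, hr',
            Function.update_self, Finset.sum_congr rfl fun j hj => by
              rw [← Function.update_of_ne (Finset.ne_of_mem_erase hj) t r]]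
          ring
        have hPr : P = (∏ j ∈ Finset.Icc 2 b,
            ((connectedCount j : ℝ) / (j.factorial : ℝ)) ^ r' j) *
              ((connectedCount (k + 1) : ℝ) / ((k + 1).factorial : ℝ)) := by
          rw [hP, ← Finset.mul_prod_erase _ _ hs, ← Finset.mul_prod_erase _ _ hs, ht, hr',
            Function.update_self, Finset.prod_congr rfl fun j hj => by
              rw [← Function.update_of_ne (Finset.ne_of_mem_erase hj) t r], pow_succ]
          ring
        have hprod : ∀ f : Fin (n - k) → Fin (n - k), ∏ j ∈ Finset.Icc 2 b,
            (((Pi.single (k + 1) 1 + componentCount f : ℕ → ℕ) j).descFactorial (r j) : ℝ) =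
            (∏ j ∈ Finset.Icc 2 b, ((componentCount f j).descFactorial (r j) : ℝ)) +
            (t + 1) * ∏ j ∈ Finset.Icc 2 b, ((componentCount f j).descFactorial (r' j) : ℝ) := by
          intro f
          have e1 : ∀ j ∈ (Finset.Icc 2 b).erase (k + 1),
              (((Pi.single (k + 1) 1 + componentCount f : ℕ → ℕ) j).descFactorial (r j) : ℝ) =
                ((componentCount f j).descFactorial (r j) : ℝ) := fun j hj => by
            simp [Finset.ne_of_mem_erase hj]
          have e2 : ∀ j ∈ (Finset.Icc 2 b).erase (k + 1),
              ((componentCount f j).descFactorial (r' j) : ℝ) =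
                ((componentCount f j).descFactorial (r j) : ℝ) := fun j hj => by
            rw [hr', Function.update_of_ne (Finset.ne_of_mem_erase hj)]
          rw [← Finset.mul_prod_erase _ _ hs, ← Finset.mul_prod_erase _ _ hs,
            ← Finset.mul_prod_erase _ _ hs, Finset.prod_congr rfl e1, Finset.prod_congr rfl e2,
            ht, hr', Function.update_self, Pi.add_apply, Pi.single_eq_same, add_comm 1,
            descFactorial_succ_left]
          push_cast
          ring
        rw [Finset.sum_congr rfl fun f _ => hprod f, Finset.sum_add_distrib, ← Finset.mul_sum,
          ih (n - k) (by omega) r' _ rfl, if_pos hs, ht, hPr]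
        set m' := ∑ j ∈ Finset.Icc 2 b, j * r' j
        have hd : (k.factorial : ℝ) * n.choose k * (n - k).descFactorial m' =
            n.descFactorial (m - 1) := by
          rw [← Nat.cast_mul, ← Nat.descFactorial_eq_factorial_mul_choose, ← Nat.cast_mul,
            show m - 1 = k + m' by omega,
            ← Nat.descFactorial_mul_descFactorial (Nat.le_add_right k m'),
            Nat.add_sub_cancel_left, mul_comm]
        have hpow : ((n - k).descFactorial m' : ℝ) * (((n - k : ℕ) : ℝ) - m' - 1) ^ (n - k - m') =
            ((n - k).descFactorial m' : ℝ) * ((n : ℝ) - m) ^ (n + 1 - m) := by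
          rw [show n + 1 - m = n - k - m' by omega, hsum, Nat.cast_sub hk']
          push_cast
          ring
        rw [hpow, ← hd, Nat.factorial_succ]
        have h1 : (k.factorial : ℝ) ≠ 0 := by positivity
        have h5 : (k : ℝ) + 1 ≠ 0 := by positivity
        push_cast
        field_simp
      rw [Finset.sum_congr rfl hterm, Finset.sum_add_distrib, ← Finset.sum_mul, ← Nat.cast_sum]
      -- After `choose_mul_descFactorial_sub` this is the recursion for `connectedCount` on `n - m`;
      -- terms with `k > n - m` vanish.
      have hfirst : ∑ k ∈ Finset.range (n + 1), (n.choose k : ℝ) * connectedCount (k + 1) *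
            (P * (((n - k).descFactorial m : ℝ) * (((n - k : ℕ) : ℝ) - m - 1) ^ (n - k - m))) =
          P * ((n.descFactorial m : ℝ) * ((n : ℝ) - m) ^ (n + 1 - m)) := by
        rcases lt_or_ge n m with hnm | hnm
        · rw [Nat.descFactorial_eq_zero_iff_lt.2 hnm, Finset.sum_eq_zero]
          · simp
          · intro k _
            rw [Nat.descFactorial_eq_zero_iff_lt.2 (lt_of_le_of_lt (Nat.sub_le n k) hnm)]
            simp
        · have h := sum_choose_mul_connectedCount (n - m)
          rw [show n + 1 - m = n - m + 1 by omega, ← Nat.cast_sub hnm, ← h, Finset.mul_sum,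
            Finset.mul_sum]
          symm
          refine Finset.sum_subset_zero_on_sdiff (Finset.range_subset_range.2 (by omega)) ?_ ?_
          · intro k hk
            simp only [Finset.mem_sdiff, Finset.mem_range] at hk
            rw [Nat.descFactorial_eq_zero_iff_lt.2 (by omega)]
            simp
          · intro k hk
            have hk' := Finset.mem_range.1 hk
            have hc : (n.choose k : ℝ) * (n - k).descFactorial m =
                n.descFactorial m * (n - m).choose k := by
              exact_mod_cast choose_mul_descFactorial_sub n k m
            rw [show n - m - k = n - k - m by omega, Nat.cast_sub (show m ≤ n - k by omega)]
            linear_combination (-P * connectedCount (k + 1) *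
              (((n - k : ℕ) : ℝ) - m - 1) ^ (n - k - m)) * hc
      rw [hfirst]
      rcases lt_or_ge (n + 1) m with hnm | hnm
      · rw [Nat.descFactorial_eq_zero_iff_lt.2 hnm,
          Nat.descFactorial_eq_zero_iff_lt.2 (show n < m by omega),
          Nat.descFactorial_eq_zero_iff_lt.2 (show n < m - 1 by omega)]
        simp
      · rw [sum_range_ite_mem_Icc b n r (hm ▸ hnm), ← hm]
        -- The two parts recombine by the same Pascal rule, the second with weight `∑ j * r j = m`.
        have hd : ((n + 1).descFactorial m : ℝ) =
            n.descFactorial m + m * n.descFactorial (m - 1) := by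
          rcases m with _ | m
          · simp
          · exact_mod_cast descFactorial_succ_left n m
        rw [hd]
        push_cast
        rw [show (n : ℝ) + 1 - m - 1 = n - m by ring]
        ring

end Counting

/-! ### From counts to probabilities and expectations. -/

section Law

theorem isProbabilityMeasure_uniformOn_ne {n : ℕ} (hn : 2 ≤ n) (i : Fin n) :
    IsProbabilityMeasure (uniformOn {j : Fin n | j ≠ i}) := by
  have : Nontrivial (Fin n) := Fin.nontrivial_iff_two_le.2 hn
  exact isProbabilityMeasure_uniformOn (Set.toFinite _) (exists_ne i)

theorem isProbabilityMeasure_toesLaw {n : ℕ} (hn : 2 ≤ n) : IsProbabilityMeasure (toesLaw n) := by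
  have := isProbabilityMeasure_uniformOn_ne hn
  unfold toesLaw
  infer_instance

theorem uniformOn_ne_real_singleton {n : ℕ} (hn : 2 ≤ n) (i j : Fin n) :
    (uniformOn {j : Fin n | j ≠ i}).real {j} = if j ≠ i then ((n : ℝ) - 1)⁻¹ else 0 := by
  have h1 : {j : Fin n | j ≠ i} = ((Finset.univ.erase i : Finset (Fin n)) : Set (Fin n)) := by
    ext
    simp
  have hn1 : ((n - 1 : ℕ) : ℝ) = n - 1 := by
    rw [Nat.cast_sub (by omega), Nat.cast_one]
  rw [h1, ← Finset.coe_singleton, measureReal_def, uniformOn_apply_finset]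
  by_cases h : j = i
  · simp [h]
  · rw [← hn1]
    simp [h, -ENNReal.natCast_sub]

theorem toesLaw_real_singleton {n : ℕ} (hn : 2 ≤ n) (f : Fin n → Fin n)
    [Decidable (f ∈ toesMaps (Fin n))] :
    (toesLaw n).real {f} = if f ∈ toesMaps (Fin n) then (((n : ℝ) - 1) ^ n)⁻¹ else 0 := by
  have := isProbabilityMeasure_uniformOn_ne hn
  rw [toesLaw, measureReal_def, Measure.pi_singleton, ENNReal.toReal_prod]
  simp only [← measureReal_def, uniformOn_ne_real_singleton hn]
  split_ifs with h
  · rw [mem_toesMaps] at h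
    simp [h]
  · rw [mem_toesMaps] at h
    push Not at h
    obtain ⟨i, hi⟩ := h
    exact Finset.prod_eq_zero (Finset.mem_univ i) (by simp [hi])

theorem integral_toesLaw {n : ℕ} (hn : 2 ≤ n) (F : (Fin n → Fin n) → ℝ) :
    ∫ f, F f ∂(toesLaw n) = (∑ f ∈ toesMaps (Fin n), F f) / ((n : ℝ) - 1) ^ n := by
  classical
  have := isProbabilityMeasure_toesLaw hn
  rw [integral_fintype .of_finite]
  simp only [toesLaw_real_singleton hn, smul_eq_mul, ite_mul, zero_mul]
  rw [Finset.sum_ite_mem, Finset.univ_inter, ← Finset.mul_sum, div_eq_inv_mul]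

open Classical in
theorem toesLaw_real {n : ℕ} (hn : 2 ≤ n) (p : (Fin n → Fin n) → Prop) :
    (toesLaw n).real {f | p f} =
      (∑ f ∈ toesMaps (Fin n), if p f then (1 : ℝ) else 0) / ((n : ℝ) - 1) ^ n := by
  rw [← integral_toesLaw hn, ← integral_indicator_one (Set.toFinite _).measurableSet]
  refine integral_congr_ae (.of_forall fun f => ?_)
  by_cases h : p f <;> simp [h]

theorem toesLaw_real_componentCount_eq {n : ℕ} (hn : 2 ≤ n) (a : ℕ → ℕ) :
    (toesLaw n).real {f | ∀ j ∈ Finset.Icc 2 n, componentCount f j = a j} =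
      if ∑ j ∈ Finset.Icc 2 n, j * a j = n then
        (n.factorial : ℝ) / ((n : ℝ) - 1) ^ n * ∏ j ∈ Finset.Icc 2 n,
          (((connectedCount j : ℝ) / (j.factorial : ℝ)) ^ a j * (1 / ((a j).factorial : ℝ)))
      else 0 := by
  rw [toesLaw_real hn, sum_toesMaps_ite_componentCount n n le_rfl]
  split_ifs
  · ring
  · simp

theorem integral_prod_descFactorial {n : ℕ} (hn : 2 ≤ n) (b : ℕ) (r : ℕ → ℕ) (m : ℕ)
    (hm : m = ∑ j ∈ Finset.Icc 2 b, j * r j) :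
    ∫ f, ∏ j ∈ Finset.Icc 2 b, ((componentCount f j).descFactorial (r j) : ℝ) ∂(toesLaw n) =
      (∏ j ∈ Finset.Icc 2 b, ((connectedCount j : ℝ) / (j.factorial : ℝ)) ^ r j) *
        ((n.descFactorial m : ℝ) * (((n : ℝ) - m - 1) ^ (n - m) / ((n : ℝ) - 1) ^ n)) := by
  rw [integral_toesLaw hn, sum_toesMaps_prod_descFactorial b n r m hm]
  ring

theorem integral_componentCount {n : ℕ} (hn : 2 ≤ n) {j : ℕ} (hj : 2 ≤ j) :
    ∫ f, (componentCount f j : ℝ) ∂(toesLaw n) =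
      (connectedCount j : ℝ) / (j.factorial : ℝ) *
        ((n.descFactorial j : ℝ) * (((n : ℝ) - j - 1) ^ (n - j) / ((n : ℝ) - 1) ^ n)) := by
  have hmem : j ∈ Finset.Icc 2 j := Finset.mem_Icc.2 ⟨hj, le_rfl⟩
  have h := integral_prod_descFactorial hn j (Pi.single j 1) j (by
    rw [Finset.sum_eq_single_of_mem j hmem fun i _ hi => by simp [hi]]
    simp)
  rw [Finset.prod_eq_single_of_mem j hmem fun i _ hi => by simp [hi]] at h
  simp only [Pi.single_eq_same, pow_one] at h
  rw [← h]
  congr 1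
  funext f
  rw [Finset.prod_eq_single_of_mem j hmem fun i _ hi => by simp [hi]]
  simp

theorem integral_componentCount_mul {n : ℕ} (hn : 2 ≤ n) {i j : ℕ} (hi : 2 ≤ i) (hj : 2 ≤ j) :
    ∫ f, ((componentCount f i : ℝ) * ((componentCount f j : ℝ) - if i = j then 1 else 0))
        ∂(toesLaw n) =
      (connectedCount i : ℝ) / (i.factorial : ℝ) * ((connectedCount j : ℝ) / (j.factorial : ℝ)) *
        ((n.descFactorial (i + j) : ℝ) *
          (((n : ℝ) - i - j - 1) ^ (n - i - j) / ((n : ℝ) - 1) ^ n)) := by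
  have hmi : i ∈ Finset.Icc 2 (i + j) := Finset.mem_Icc.2 ⟨hi, by omega⟩
  have hmj : j ∈ Finset.Icc 2 (i + j) := Finset.mem_Icc.2 ⟨hj, by omega⟩
  have hsingle : ∀ (k : ℕ), k ∈ Finset.Icc 2 (i + j) →
      ∑ l ∈ Finset.Icc 2 (i + j), l * (Pi.single k 1 : ℕ → ℕ) l = k := fun k hk => by
    rw [Finset.sum_eq_single_of_mem k hk fun l _ hl => by simp [hl]]
    simp
  have hsinglep : ∀ (k : ℕ), k ∈ Finset.Icc 2 (i + j) → ∀ F : ℕ → ℝ,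
      ∏ l ∈ Finset.Icc 2 (i + j), F l ^ (Pi.single k 1 : ℕ → ℕ) l = F k := fun k hk F => by
    rw [Finset.prod_eq_single_of_mem k hk fun l _ hl => by simp [hl]]
    simp
  -- The exponent `Pi.single i 1 + Pi.single j 1` covers both cases: at `i = j` it is `2`, which
  -- gives the correction by `1`.
  have h := integral_prod_descFactorial hn (i + j) (Pi.single i 1 + Pi.single j 1) (i + j) (by
    simp only [Pi.add_apply, mul_add]
    rw [Finset.sum_add_distrib, hsingle i hmi, hsingle j hmj])
  simp only [Pi.add_apply, pow_add] at h
  rw [Finset.prod_mul_distrib, hsinglep i hmi, hsinglep j hmj] at h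
  rw [Nat.sub_sub, sub_sub (n : ℝ), ← Nat.cast_add, ← h]
  congr 1
  funext f
  by_cases hij : i = j
  · subst hij
    rw [Finset.prod_eq_single_of_mem i hmi fun l _ hl => by simp [hl]]
    rcases hc : componentCount f i with _ | c <;> simp [Nat.descFactorial]
    ring
  · rw [← Finset.mul_prod_erase _ _ hmi, Finset.prod_eq_single_of_mem j
      (Finset.mem_erase.2 ⟨Ne.symm hij, hmj⟩) fun l hl hlj => by
        simp [hlj, Finset.ne_of_mem_erase hl]]
    simp [hij, Ne.symm hij]

/-- There is at most one component of size `n`, so its count is an indicator and the probability is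
a mean. -/
theorem singleProb_eq {n : ℕ} (hn : 2 ≤ n) :
    singleProb n = (connectedCount n : ℝ) / ((n : ℝ) - 1) ^ n := by
  have h := integral_componentCount hn hn
  rw [Nat.sub_self, pow_zero, Nat.descFactorial_self, integral_toesLaw hn] at h
  have h0 : (n.factorial : ℝ) ≠ 0 := by positivity
  rw [singleProb, toesLaw_real hn]
  have h1 : (connectedCount n : ℝ) / ((n : ℝ) - 1) ^ n =
      connectedCount n / n.factorial * (n.factorial * (1 / ((n : ℝ) - 1) ^ n)) := by
    field_simp
  rw [h1, ← h]
  congr 1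
  refine Finset.sum_congr rfl fun f hf => ?_
  have hle : n * componentCount f n ≤ n := by
    conv_rhs => rw [← sum_mul_componentCount le_rfl hf]
    exact Finset.single_le_sum (f := fun j => j * componentCount f j) (fun _ _ => Nat.zero_le _)
      (Finset.mem_Icc.2 ⟨hn, le_rfl⟩)
  have hle1 : componentCount f n ≤ 1 := by
    by_contra hlt
    have := Nat.mul_le_mul_left n (show 2 ≤ componentCount f n by omega)
    omega
  interval_cases componentCount f n <;> simp

end Law

/-! ### Poisson form of the connected counts. -/

section Rates

theorem poissonBelow_eq (i : ℕ) :
    (poissonBelow i : ℝ) =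
      Real.exp (-(i : ℝ)) * ∑ k ∈ Finset.range (i - 1), (i : ℝ) ^ k / (k.factorial : ℝ) := by
  have h : {k : ℕ | (k : ℤ) < (i : ℤ) - 1} = (Finset.range (i - 1) : Set ℕ) := by
    ext k
    simp
    omega
  rw [poissonBelow, ENNReal.coe_toNNReal_eq_toReal, ← measureReal_def, h,
    ← sum_measureReal_singleton, Finset.mul_sum]
  refine Finset.sum_congr rfl fun k _ => ?_
  rw [poissonMeasure_real_singleton]
  simp [mul_div_assoc]

theorem connectedCount_eq {i : ℕ} (hi : 1 ≤ i) :
    (connectedCount i : ℝ) =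
      ((i - 1).factorial : ℝ) * Real.exp (i : ℝ) * (poissonBelow i : ℝ) := by
  obtain ⟨k, rfl⟩ := Nat.exists_eq_add_of_le' hi
  rw [connectedCount_succ, poissonBelow_eq, Real.exp_neg, Nat.add_sub_cancel]
  have := (Real.exp_pos ((k + 1 : ℕ) : ℝ)).ne'
  field_simp
  push_cast
  rfl

theorem toesRate_eq {i : ℕ} (hi : 1 ≤ i) :
    (toesRate i : ℝ) = (connectedCount i : ℝ) * Real.exp (-(i : ℝ)) / (i.factorial : ℝ) := by
  rw [connectedCount_eq hi, toesRate, Real.exp_neg, ← Nat.mul_factorial_pred (by omega : i ≠ 0)]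
  have := (Real.exp_pos (i : ℝ)).ne'
  have : (i : ℝ) ≠ 0 := by positivity
  have : ((i - 1).factorial : ℝ) ≠ 0 := by positivity
  push_cast
  field_simp

theorem connectedCount_div_factorial {i : ℕ} (hi : 1 ≤ i) :
    (connectedCount i : ℝ) / (i.factorial : ℝ) = toesRate i * Real.exp (i : ℝ) := by
  rw [toesRate_eq hi, Real.exp_neg]
  have := (Real.exp_pos (i : ℝ)).ne'
  field_simp

/-- The exponential tilt depends on `r` only through the total size, hence is constant once that
size is fixed. -/
theorem prod_connectedCount_div_factorial (b : ℕ) (r : ℕ → ℕ) :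
    ∏ j ∈ Finset.Icc 2 b, ((connectedCount j : ℝ) / (j.factorial : ℝ)) ^ r j =
      (∏ j ∈ Finset.Icc 2 b, (toesRate j : ℝ) ^ r j) *
        Real.exp ((∑ j ∈ Finset.Icc 2 b, j * r j : ℕ) : ℝ) := by
  rw [Nat.cast_sum, Real.exp_sum, ← Finset.prod_mul_distrib]
  refine Finset.prod_congr rfl fun j hj => ?_
  rw [connectedCount_div_factorial (by have := (Finset.mem_Icc.1 hj).1; omega), mul_pow,
    ← Real.exp_nat_mul]
  push_cast
  ring_nf

end Rates

/-! ### Conditioning independent Poisson variables on the total size. -/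

section Conditioning

/-- The law of independent Poisson variables, restricted to the event that the total size is `n`,
is a multiple of the law of the component counts. -/
theorem map_restrict_eq_smul {n : ℕ} (hn : 2 ≤ n) {Ω : Type*} [MeasurableSpace Ω] (μ : Measure Ω)
    [IsProbabilityMeasure μ] (Z : Finset.Icc 2 n → Ω → ℕ) (hZ : ∀ j, Measurable (Z j))
    (hind : iIndepFun Z μ) (hlaw : ∀ j, μ.map (Z j) = poissonMeasure (toesRate j)) :
    ∃ c : ENNReal, c ≠ 0 ∧ c ≠ ⊤ ∧
      (μ.restrict {ω | ∑ j : Finset.Icc 2 n, (j : ℕ) * Z j ω = n}).map (fun ω j => Z j ω) =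
        c • (toesLaw n).map (fun f (j : Finset.Icc 2 n) => componentCount f j) := by
  have := isProbabilityMeasure_toesLaw hn
  have hn1 : (0 : ℝ) < (n : ℝ) - 1 := by
    have : (2 : ℝ) ≤ n := by exact_mod_cast hn
    linarith
  -- The ratio of the Poisson weight of a count vector to its probability under `toesLaw`; it is the
  -- same for all vectors of total size `n`.
  set c : ℝ := (∏ j ∈ Finset.Icc 2 n, Real.exp (-(toesRate j : ℝ))) *
    (((n : ℝ) - 1) ^ n / (n.factorial * Real.exp n)) with hc
  have hc0 : 0 < c := by positivity
  have hZv : Measurable fun ω (j : Finset.Icc 2 n) => Z j ω := measurable_pi_lambda _ hZ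
  refine ⟨ENNReal.ofReal c, (ENNReal.ofReal_pos.2 hc0).ne', ENNReal.ofReal_ne_top, ?_⟩
  refine Measure.ext_iff_singleton.2 fun z => ?_
  set a : ℕ → ℕ := fun j => if h : j ∈ Finset.Icc 2 n then z ⟨j, h⟩ else 0 with ha
  have haz : ∀ j : Finset.Icc 2 n, a j = z j := fun j => by simp only [ha, j.2, dif_pos]
  rw [Measure.map_apply hZv (measurableSet_singleton z),
    Measure.restrict_apply (hZv (measurableSet_singleton z)), Measure.smul_apply, smul_eq_mul,
    Measure.map_apply (measurable_of_finite _) (measurableSet_singleton z)]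
  have hC : (fun f (j : Finset.Icc 2 n) => componentCount f j) ⁻¹' {z} =
      {f : Fin n → Fin n | ∀ j ∈ Finset.Icc 2 n, componentCount f j = a j} := by
    ext f
    simp only [Set.mem_preimage, Set.mem_singleton_iff, funext_iff, Set.mem_ofPred_eq]
    rw [Subtype.forall]
    exact forall₂_congr fun j hj => by rw [← haz ⟨j, hj⟩]
  have hsum : ∑ j : Finset.Icc 2 n, (j : ℕ) * z j = ∑ j ∈ Finset.Icc 2 n, j * a j := by
    rw [← Finset.sum_coe_sort (Finset.Icc 2 n) fun j => j * a j]
    exact Finset.sum_congr rfl fun j _ => by rw [haz]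
  rw [hC, ← ENNReal.toReal_eq_toReal_iff' (measure_ne_top _ _)
    (ENNReal.mul_ne_top ENNReal.ofReal_ne_top (measure_ne_top _ _)), ENNReal.toReal_mul,
    ENNReal.toReal_ofReal hc0.le, ← measureReal_def (toesLaw n),
    toesLaw_real_componentCount_eq hn a]
  by_cases hT : ∑ j ∈ Finset.Icc 2 n, j * a j = n
  · have hset : (fun ω (j : Finset.Icc 2 n) => Z j ω) ⁻¹' {z} ∩
        {ω | ∑ j : Finset.Icc 2 n, (j : ℕ) * Z j ω = n} =
        ⋂ j ∈ (Finset.univ : Finset (Finset.Icc 2 n)), Z j ⁻¹' {z j} := by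
      ext ω
      simp only [Set.mem_inter_iff, Set.mem_preimage, Set.mem_singleton_iff, funext_iff,
        Set.mem_ofPred_eq, Set.mem_iInter, Finset.mem_univ, true_imp_iff, and_iff_left_iff_imp]
      intro h
      simp only [h]
      rw [hsum, hT]
    rw [hset, hind.measure_inter_preimage_eq_mul Finset.univ
      fun j _ => measurableSet_singleton (z j), if_pos hT, ENNReal.toReal_prod]
    have hfac : ∀ j : Finset.Icc 2 n, (μ (Z j ⁻¹' {z j})).toReal =
        Real.exp (-(toesRate j : ℝ)) * (toesRate j : ℝ) ^ a j * (1 / ((a j).factorial : ℝ)) := by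
      intro j
      rw [← Measure.map_apply (hZ j) (measurableSet_singleton _), hlaw, ← measureReal_def,
        poissonMeasure_real_singleton, haz]
      ring
    rw [Finset.prod_congr rfl fun j _ => hfac j, Finset.prod_coe_sort (Finset.Icc 2 n) fun j =>
      Real.exp (-(toesRate j : ℝ)) * (toesRate j : ℝ) ^ a j * (1 / ((a j).factorial : ℝ)),
      Finset.prod_mul_distrib, Finset.prod_mul_distrib, Finset.prod_mul_distrib,
      prod_connectedCount_div_factorial, hT]
    rw [hc]
    have h1 := (Real.exp_pos (n : ℝ)).ne'
    have h2 : (n.factorial : ℝ) ≠ 0 := by positivity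
    have h3 := hn1.ne'
    field_simp
  · rw [if_neg hT, mul_zero]
    have hset : (fun ω (j : Finset.Icc 2 n) => Z j ω) ⁻¹' {z} ∩
        {ω | ∑ j : Finset.Icc 2 n, (j : ℕ) * Z j ω = n} = ∅ := by
      rw [Set.eq_empty_iff_forall_notMem]
      rintro ω ⟨h1, h2⟩
      simp only [Set.mem_preimage, Set.mem_singleton_iff, funext_iff] at h1
      simp only [Set.mem_ofPred_eq, h1] at h2
      exact hT (hsum ▸ h2)
    rw [hset, measure_empty, ENNReal.toReal_zero]

theorem map_componentCount_eq_map_cond {n : ℕ} (hn : 2 ≤ n) {Ω : Type*} [MeasurableSpace Ω]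
    (μ : Measure Ω) [IsProbabilityMeasure μ] (Z : Finset.Icc 2 n → Ω → ℕ)
    (hZ : ∀ j, Measurable (Z j)) (hind : iIndepFun Z μ)
    (hlaw : ∀ j, μ.map (Z j) = poissonMeasure (toesRate j)) :
    μ {ω | ∑ j : Finset.Icc 2 n, (j : ℕ) * Z j ω = n} ≠ 0 ∧
      (toesLaw n).map (fun f (j : Finset.Icc 2 n) => componentCount f j) =
        (μ[|{ω | ∑ j : Finset.Icc 2 n, (j : ℕ) * Z j ω = n}]).map (fun ω j => Z j ω) := by
  have := isProbabilityMeasure_toesLaw hn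
  obtain ⟨c, hc0, hctop, hc⟩ := map_restrict_eq_smul hn μ Z hZ hind hlaw
  have hZv : Measurable fun ω (j : Finset.Icc 2 n) => Z j ω := measurable_pi_lambda _ hZ
  -- Comparing total masses identifies `c` as the probability of the event, so positivity and
  -- normalization come together.
  have hT : μ {ω | ∑ j : Finset.Icc 2 n, (j : ℕ) * Z j ω = n} = c := by
    have h := congrArg (fun ν => ν Set.univ) hc
    rw [Measure.map_apply hZv .univ, Set.preimage_univ, Measure.restrict_apply_univ,
      Measure.smul_apply, Measure.map_apply (measurable_of_finite _) .univ, Set.preimage_univ,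
      measure_univ, smul_eq_mul, mul_one] at h
    exact h
  refine ⟨hT ▸ hc0, ?_⟩
  rw [ProbabilityTheory.cond, Measure.map_smul, hc, hT, smul_smul,
    ENNReal.inv_mul_cancel hc0 hctop, one_smul]

end Conditioning

end ScreamingToes

/-! ### Assembly of the statements. -/

theorem mainTheorem5 :
    -- the number of connected mappings, and the two forms of the rates
    (∀ i : ℕ, 1 ≤ i →
      (connectedCount i : ℝ) =
          ((i - 1).factorial : ℝ) * Real.exp (i : ℝ) * (poissonBelow i : ℝ) ∧
      (toesRate i : ℝ) =
          (connectedCount i : ℝ) * Real.exp (-(i : ℝ)) / (i.factorial : ℝ)) ∧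
    (∀ n : ℕ, 2 ≤ n →
      -- the joint law of the component counts
      (∀ (x : ℝ), 0 < x → ∀ a : ℕ → ℕ,
        (toesLaw n).real {f | ∀ j ∈ Finset.Icc 2 n, componentCount f j = a j} =
          if ∑ j ∈ Finset.Icc 2 n, j * a j = n then
            (x ^ n)⁻¹ * (n.factorial : ℝ) / ((n : ℝ) - 1) ^ n *
              ∏ j ∈ Finset.Icc 2 n,
                (((connectedCount j : ℝ) * x ^ j / (j.factorial : ℝ)) ^ a j *
                  (1 / ((a j).factorial : ℝ)))
          else 0) ∧
      -- the joint law as a conditioned law of independent Poisson variables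
      (∀ (Ω : Type*) [MeasurableSpace Ω] (μ : Measure Ω) [IsProbabilityMeasure μ]
          (Z : Finset.Icc 2 n → Ω → ℕ),
        (∀ j, Measurable (Z j)) → iIndepFun Z μ →
        (∀ j, μ.map (Z j) = poissonMeasure (toesRate j)) →
          μ {ω | ∑ j : Finset.Icc 2 n, (j : ℕ) * Z j ω = n} ≠ 0 ∧
          (toesLaw n).map (fun f (j : Finset.Icc 2 n) => componentCount f j) =
            (μ[|{ω | ∑ j : Finset.Icc 2 n, (j : ℕ) * Z j ω = n}]).map (fun ω j => Z j ω)) ∧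
      -- the probability of a single component
      singleProb n =
        Real.exp (n : ℝ) * (n.factorial : ℝ) / ((n : ℝ) - 1) ^ n * (toesRate n : ℝ) ∧
      -- the joint falling factorial moments
      (∀ (b : ℕ) (r : ℕ → ℕ) (m : ℕ), m = ∑ j ∈ Finset.Icc 2 b, j * r j → m ≤ n →
        ∫ f, ∏ j ∈ Finset.Icc 2 b, ((componentCount f j).descFactorial (r j) : ℝ) ∂(toesLaw n) =
          (∏ j ∈ Finset.Icc 2 b, (toesRate j : ℝ) ^ r j) *
            (Real.exp (m : ℝ) * (n.descFactorial m : ℝ) *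
              (((n : ℝ) - m - 1) ^ (n - m) / ((n : ℝ) - 1) ^ n))) ∧
      -- the means
      (∀ j : ℕ, 2 ≤ j → j ≤ n →
        ∫ f, (componentCount f j : ℝ) ∂(toesLaw n) =
          (toesRate j : ℝ) * Real.exp (j : ℝ) * (n.descFactorial j : ℝ) *
            (((n : ℝ) - j - 1) ^ (n - j) / ((n : ℝ) - 1) ^ n) ∧
        ∫ f, (componentCount f j : ℝ) ∂(toesLaw n) =
          singleProb j * (n.choose j : ℝ) * (((j : ℝ) - 1) / ((n : ℝ) - 1)) ^ j *
            (1 - (j : ℝ) / ((n : ℝ) - 1)) ^ (n - j)) ∧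
      -- the second moments, for `i ≠ j` and for `i = j`
      (∀ i j : ℕ, 2 ≤ i → 2 ≤ j →
        ∫ f, ((componentCount f i : ℝ) *
            ((componentCount f j : ℝ) - if i = j then 1 else 0)) ∂(toesLaw n) =
          if i + j ≤ n then
            singleProb i * singleProb j *
              ((n.factorial : ℝ) /
                ((i.factorial : ℝ) * (j.factorial : ℝ) * ((n - i - j).factorial : ℝ))) *
              (((i : ℝ) - 1) / ((n : ℝ) - 1)) ^ i * (((j : ℝ) - 1) / ((n : ℝ) - 1)) ^ j *
              (1 - ((i : ℝ) + j) / ((n : ℝ) - 1)) ^ (n - i - j)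
          else 0)) := by
  refine ⟨fun i hi => ⟨connectedCount_eq hi, toesRate_eq hi⟩, fun n hn => ?_⟩
  have hn1 : (n : ℝ) - 1 ≠ 0 := by
    have : (2 : ℝ) ≤ n := by exact_mod_cast hn
    linarith
  refine ⟨fun x hx a => ?_, ?_, ?_, ?_, fun j hj hjn => ?_, fun i j hi hj => ?_⟩
  · rw [toesLaw_real_componentCount_eq hn]
    refine if_ctx_congr Iff.rfl (fun h => ?_) fun _ => rfl
    have hprod : ∏ j ∈ Finset.Icc 2 n, (((connectedCount j : ℝ) * x ^ j / (j.factorial : ℝ)) ^ a j *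
        (1 / ((a j).factorial : ℝ))) = (∏ j ∈ Finset.Icc 2 n,
          (((connectedCount j : ℝ) / (j.factorial : ℝ)) ^ a j * (1 / ((a j).factorial : ℝ)))) *
            x ^ n := by
      rw [← h, ← Finset.prod_pow_eq_pow_sum, h, ← Finset.prod_mul_distrib]
      refine Finset.prod_congr rfl fun j _ => ?_
      rw [pow_mul, mul_div_right_comm, mul_pow]
      ring
    rw [hprod]
    field_simp
  · intro Ω _ μ _ Z hZ hind hlaw
    exact map_componentCount_eq_map_cond hn μ Z hZ hind hlaw
  · rw [singleProb_eq hn, toesRate_eq (by omega), Real.exp_neg]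
    have := (Real.exp_pos (n : ℝ)).ne'
    field_simp
  · intro b r m hm _
    rw [integral_prod_descFactorial hn b r m hm, prod_connectedCount_div_factorial, ← hm]
    ring
  · rw [integral_componentCount hn hj]
    refine ⟨?_, ?_⟩
    · rw [connectedCount_div_factorial (by omega)]
      ring
    -- `singleProb j` carries a denominator `(j - 1) ^ j`, which must cancel.
    · have hj1 : (j : ℝ) - 1 ≠ 0 := by
        have : (2 : ℝ) ≤ j := by exact_mod_cast hj
        linarith
      rw [singleProb_eq hj, one_sub_div hn1, Nat.descFactorial_eq_factorial_mul_choose, div_pow,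
        div_pow, show ((n : ℝ) - 1) ^ n = ((n : ℝ) - 1) ^ j * ((n : ℝ) - 1) ^ (n - j) by
          rw [← pow_add, Nat.add_sub_cancel' hjn], sub_right_comm]
      push_cast
      field_simp
  · rw [integral_componentCount_mul hn hi hj]
    split_ifs with hij
    · have hi1 : (i : ℝ) - 1 ≠ 0 := by
        have : (2 : ℝ) ≤ i := by exact_mod_cast hi
        linarith
      have hj1 : (j : ℝ) - 1 ≠ 0 := by
        have : (2 : ℝ) ≤ j := by exact_mod_cast hj
        linarith
      rw [singleProb_eq hi, singleProb_eq hj, one_sub_div hn1, div_pow, div_pow, div_pow,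
        show ((n : ℝ) - 1) ^ n =
          ((n : ℝ) - 1) ^ i * ((n : ℝ) - 1) ^ j * ((n : ℝ) - 1) ^ (n - i - j) by
            rw [← pow_add, ← pow_add]; congr 1; omega,
        ← Nat.factorial_mul_descFactorial hij, Nat.sub_sub,
        show (n : ℝ) - i - j - 1 = n - 1 - (i + j) by ring]
      have : ((n - (i + j)).factorial : ℝ) ≠ 0 := by positivity
      push_cast
      field_simp
    · rw [Nat.descFactorial_eq_zero_iff_lt.2 (not_le.1 hij)]
      simp
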